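/- Let $Y$ be a finite-dimensional complex vector space of even dimension, with its usual topology, endowed with a non-degenerate symmetric bilinear form. A subspace is called isotropic if the form vanishes identically on it. Let $\mathcal{G}r(Y)$ be the set of all maximal (with respect to inclusion) isotropic subspaces of $Y$, with the topology induced from the disjoint union of the Grassmannians of $k$-dimensional subspaces of $Y$, $0\le k\le\dim Y$ (each of these has the quotient topology from the space of linearly independent $k$-tuples in $Y$). Then: 1. If $Y\neq 0$, then $\mathcal{G}r(Y)$ has exactly two connected components. 2. Two subspaces $H_1,H_2\in\mathcal{G}r(Y)$ lie in the same connected component of $\mathcal{G}r(Y)$ if and only if the codimension of $H_1\cap H_2$ in $H_1$ and the codimension of $H_1\cap H_2$ in $H_2$ are both even. -/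

import Mathlib

/-- The type of all `k`-frames of `Y`, i.e. of linearly independent `k`-tuples of vectors, topologized
as a subspace of the product `Y ^ k`. -/
abbrev Frames (Y : Type*) [AddCommGroup Y] [Module ℂ Y] (k : ℕ) : Type _ :=
  {v : Fin k → Y // LinearIndependent ℂ v}

/-- The subspace spanned by a frame (of any length `k`). -/
def frameSpan (Y : Type*) [AddCommGroup Y] [Module ℂ Y] (v : Σ k : ℕ, Frames Y k) :
    Submodule ℂ Y :=
  Submodule.span ℂ (Set.range v.2.1)

/-- The usual topology on the set of all linear subspaces of a finite-dimensional complex vector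
space `Y`: the disjoint union over `k` of the Grassmannians of `k`-dimensional subspaces, each of
which carries the quotient topology coming from the space of `k`-frames. -/
abbrev grassmannianTopology (Y : Type*) [AddCommGroup Y] [Module ℂ Y] [TopologicalSpace Y] :
    TopologicalSpace (Submodule ℂ Y) :=
  TopologicalSpace.coinduced (frameSpan Y) inferInstance

/-- `W` is isotropic for `B` if `B` vanishes identically on `W`. -/
def IsIsotropic {Y : Type*} [AddCommGroup Y] [Module ℂ Y] (B : LinearMap.BilinForm ℂ Y)
    (W : Submodule ℂ Y) : Prop :=
  ∀ x ∈ W, ∀ y ∈ W, B x y = 0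

/-- The Grassmannian of all maximal isotropic subspaces of `(Y, B)`; maximality is with respect to
inclusion among isotropic subspaces. -/
def IsotropicGrassmannian {Y : Type*} [AddCommGroup Y] [Module ℂ Y]
    (B : LinearMap.BilinForm ℂ Y) : Type _ :=
  {W : Submodule ℂ Y // Maximal (IsIsotropic B) W}

/-- The Grassmannian of maximal isotropic subspaces carries the subspace topology. -/
instance IsotropicGrassmannian.instTopologicalSpace {Y : Type*} [AddCommGroup Y] [Module ℂ Y] [TopologicalSpace Y]
    (B : LinearMap.BilinForm ℂ Y) : TopologicalSpace (IsotropicGrassmannian B) :=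
  TopologicalSpace.induced Subtype.val (grassmannianTopology Y)

/-- The codimension of `H ∩ W` in `H`, i.e. the dimension of the quotient `H / (H ∩ W)`. -/
noncomputable def codimInter {Y : Type*} [AddCommGroup Y] [Module ℂ Y] (H W : Submodule ℂ Y) : ℕ :=
  Module.finrank ℂ (H ⧸ (H ⊓ W).submoduleOf H)

/-!
The idea is to separate the components by a continuous sign. In coordinates for which the form is
the dot product of `ℂ²ᵐ`, a maximal isotropic subspace `H` has dimension `m`
(`two_mul_finrank_of_maximal`), and it is Hermitian orthogonal to its complex conjugate. If `A` is
the `2m × m` matrix of a frame of `H`, then `det [A | Ā] / det (Aᴴ A)`, the *phase* of `H`, does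
not depend on the frame. It is continuous on the Grassmannian (`continuous_subspacePhase`), and on
isotropic subspaces its square is `(-1) ^ m` (`subspacePhase_sq`). So it is constant on connected
components. (It encodes the orientation of the orthogonal complex structure of `ℝ²ᵐ` whose
`i`-eigenspace is `H`.)

For two maximal isotropic subspaces `H₁`, `H₂` with intersection `K` of codimension `r`, the form
pairs `H₁ / K` and `H₂ / K` perfectly. So there are a basis `k` of `K` and dual families `a`, `b`
of `r` vectors completing `k` to bases of `H₁` and `H₂` (`exists_isHyperbolicFrame`).

* If `r` is even, let `J` be an invertible skew-symmetric `r × r` matrix. The frames `(k, (1 - t)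
  a + t J b)` stay isotropic and join `H₁` to `H₂` (`connectedComponent_eq_of_even`).
* Exchanging a single vector of `a` for its partner in `b` changes the sign of the phase
  (`subspacePhase_update`): it amounts to replacing a vector Hermitian orthogonal to the others by
  its conjugate, that is, to exchanging two columns of `[A | Ā]`. If `r` is odd, one such exchange
  leads to the even case, so the phases of `H₁` and `H₂` are opposite
  (`subspacePhase_eq_neg_of_odd_codimInter`).

Hence the components are the fibres of the phase, and the phase takes both its values as soon as
`m ≠ 0`, by one exchange (`exists_subspacePhase_eq_neg`).
-/

/-! ### The phase of a matrix -/

section Phase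

open Matrix

variable {ι : Type*} [Fintype ι] [DecidableEq ι]

/-- The number `det [A | Ā] / det (Aᴴ A)` attached to a matrix `A` of size `2m × m`. The columns
of `A` are the coordinates of a frame, and `phase A` depends only on the subspace spanned by them
(`phase_mul`). Both determinants transform by `|det P|²` under a change of frame `P`, whence the
quotient. The value at a matrix of rank less than `m` is the junk value `0`. -/
noncomputable def phase (A : Matrix (ι ⊕ ι) ι ℂ) : ℂ :=
  (fromCols A (A.map star)).det / (Aᴴ * A).det

theorem phase_mul (A : Matrix (ι ⊕ ι) ι ℂ) {P : Matrix ι ι ℂ} (hP : P.det ≠ 0) :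
    phase (A * P) = phase A := by
  have h1 : fromCols (A * P) ((A * P).map star)
      = fromCols A (A.map star) * fromBlocks P 0 0 (P.map star) := by
    rw [fromCols_mul_fromBlocks]
    have : (A * P).map star = A.map star * P.map star := by
      ext i j
      simp [Matrix.mul_apply]
    rw [this]; simp
  have h2 : (P.map star).det = star P.det := by
    rw [← det_conjTranspose, ← det_transpose]; rfl
  have hP' : star P.det ≠ 0 := star_ne_zero.mpr hP
  unfold phase
  rw [h1, det_mul, det_fromBlocks_zero₂₁, h2, conjTranspose_mul, Matrix.mul_assoc,
    ← Matrix.mul_assoc Aᴴ, det_mul, det_mul, det_conjTranspose]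
  field_simp

theorem det_fromCols_swap (A B : Matrix (ι ⊕ ι) ι ℂ) :
    (fromCols B A).det = (-1) ^ Fintype.card ι * (fromCols A B).det := by
  have h1 : fromCols B A = fromCols A B * fromBlocks 0 1 1 0 := by
    rw [fromCols_mul_fromBlocks]; simp
  have h2 : (fromBlocks 0 1 1 0 : Matrix (ι ⊕ ι) (ι ⊕ ι) ℂ)
      = Matrix.J ι ℂ * fromBlocks 1 0 0 (-1) := by
    simp [Matrix.J, fromBlocks_multiply]
  have h3 : (Matrix.J ι ℂ).det = 1 := by
    -- `J` is a product of three elementary block matrices.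
    have : Matrix.J ι ℂ = fromBlocks 1 (-1) 0 1 * (fromBlocks 1 0 1 1 * fromBlocks 1 (-1) 0 1) := by
      simp [Matrix.J, fromBlocks_multiply]
    rw [this]
    simp [det_mul]
  rw [h1, h2, det_mul, det_mul, det_fromBlocks_zero₂₁, h3, det_neg]
  simp [mul_comm]

/-- If the columns of `A` span an isotropic subspace for the dot product, they are Hermitian
orthogonal to their conjugates, so that `|det [A | Ā]| = det (Aᴴ A)`; and conjugation of `[A | Ā]`
permutes its two halves. So `phase A` takes only the two values `± √((-1) ^ m)`. -/
theorem phase_sq {A : Matrix (ι ⊕ ι) ι ℂ} (hA : Aᵀ * A = 0) (hG : (Aᴴ * A).det ≠ 0) :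
    phase A ^ 2 = (-1) ^ Fintype.card ι := by
  set X := fromCols A (A.map star) with hX
  set G := Aᴴ * A with hGdef
  have hGs : star G.det = G.det := by
    rw [← det_conjTranspose, hGdef, conjTranspose_mul, conjTranspose_conjTranspose]
  have h1 : Xᴴ * X = fromBlocks G 0 0 (G.map star) := by
    have e1 : (A.map star)ᴴ = Aᵀ := by ext; simp
    have e2 : Aᴴ * A.map star = 0 := by
      ext i j
      simpa [Matrix.mul_apply] using congrArg star (congrFun (congrFun hA i) j)
    have e3 : Aᵀ * A.map star = G.map star := by
      ext i j
      simp [hGdef, Matrix.mul_apply]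
    rw [hX, conjTranspose_fromCols_eq_fromRows_conjTranspose, fromRows_mul_fromCols, e1, e2, e3,
      hA]
  have h2 : star X.det * X.det = G.det * G.det := by
    have h3 : (G.map star).det = star G.det := by
      rw [← det_conjTranspose, ← det_transpose]; rfl
    rw [← det_conjTranspose, ← det_mul, h1, det_fromBlocks_zero₂₁, h3, hGs]
  have h4 : star X.det = (-1) ^ Fintype.card ι * X.det := by
    rw [← det_fromCols_swap, ← det_conjTranspose, ← det_transpose]
    congr 1
    ext i (j | j) <;> simp [hX]
  rw [h4] at h2
  have h5 : ((-1 : ℂ) ^ Fintype.card ι) * (-1) ^ Fintype.card ι = 1 := by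
    rw [← mul_pow]; simp
  unfold phase
  rw [div_pow, div_eq_iff (pow_ne_zero _ hG)]
  linear_combination (-1 : ℂ) ^ Fintype.card ι * h2 - X.det ^ 2 * h5

/-- If the column `i₀` of `A` is Hermitian orthogonal to the others, replacing it by its conjugate
exchanges two columns of `[A | Ā]` and leaves the Gram matrix unchanged, so it changes the sign of
the phase. -/
theorem phase_updateCol_star {A : Matrix (ι ⊕ ι) ι ℂ} (hA : Aᵀ * A = 0) (i₀ : ι)
    (hi : ∀ j, j ≠ i₀ → (Aᴴ * A) i₀ j = 0) :
    ((A.updateCol i₀ fun x => star (A x i₀))ᴴ * A.updateCol i₀ fun x => star (A x i₀)) = Aᴴ * A ∧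
    phase (A.updateCol i₀ fun x => star (A x i₀)) = -phase A := by
  have hi' : ∀ j, j ≠ i₀ → (Aᴴ * A) j i₀ = 0 := by
    intro j hj
    have := congrArg star (hi j hj)
    rw [← conjTranspose_apply, conjTranspose_mul, conjTranspose_conjTranspose] at this
    simpa using this
  have hA' : ∀ i j, ∑ x, A x i * A x j = 0 := by
    intro i j
    simpa [Matrix.mul_apply] using congrFun (congrFun hA i) j
  have hA'' : ∀ i j, ∑ x, star (A x i) * star (A x j) = 0 := by
    intro i j
    simpa using congrArg star (hA' i j)
  set A' := A.updateCol i₀ fun x => star (A x i₀) with hA'def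
  have hG : A'ᴴ * A' = Aᴴ * A := by
    ext i j
    by_cases h1 : i = i₀ <;> by_cases h2 : j = i₀
    · subst h1; subst h2
      simp [hA'def, Matrix.mul_apply, mul_comm]
    · subst h1
      rw [hi j h2]
      simpa [hA'def, Matrix.mul_apply, h2] using hA' i j
    · subst h2
      rw [hi' i h1]
      simpa [hA'def, Matrix.mul_apply, h1] using hA'' i j
    · simp [hA'def, Matrix.mul_apply, h1, h2]
  refine ⟨hG, ?_⟩
  have hX : fromCols A' (A'.map star) =
      (fromCols A (A.map star)).submatrix id (Equiv.swap (Sum.inl i₀) (Sum.inr i₀)) := by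
    ext x (j | j)
    · by_cases h : j = i₀
      · subst h; simp [hA'def]
      · rw [submatrix_apply, Equiv.swap_apply_of_ne_of_ne (by simpa using h) (by simp)]
        simp [hA'def, h]
    · by_cases h : j = i₀
      · subst h; simp [hA'def]
      · rw [submatrix_apply, Equiv.swap_apply_of_ne_of_ne (by simp) (by simpa using h)]
        simp [hA'def, h]
  unfold phase
  rw [hG, hX, det_permute', Equiv.Perm.sign_swap (by simp)]
  simp [neg_div]

end Phase

/-! ### Isotropic subspaces -/

section Isotropic

open Matrix Module

variable {Y : Type*} [AddCommGroup Y] [Module ℂ Y] {B : LinearMap.BilinForm ℂ Y}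

theorem isIsotropic_iff_le_orthogonal {W : Submodule ℂ Y} :
    IsIsotropic B W ↔ W ≤ B.orthogonal W :=
  ⟨fun h _ hy x hx => h x hx _ hy, fun h x hx _ hy => h hy x hx⟩

theorem isIsotropic_span {ν : Type*} {v : ν → Y} (h : ∀ i j, B (v i) (v j) = 0) :
    IsIsotropic B (Submodule.span ℂ (Set.range v)) := by
  intro x hx y hy
  induction hx, hy using Submodule.span_induction₂ with
  | mem_mem x y hx hy =>
    obtain ⟨i, rfl⟩ := hx
    obtain ⟨j, rfl⟩ := hy
    exact h i j
  | zero_left => simp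
  | zero_right => simp
  | add_left _ _ _ _ _ _ h₁ h₂ => simp [h₁, h₂]
  | add_right _ _ _ _ _ _ h₁ h₂ => simp [h₁, h₂]
  | smul_left _ _ _ _ _ h => simp [h]
  | smul_right _ _ _ _ _ h => simp [h]

theorem IsIsotropic.sup_span_singleton (hsymm : B.IsSymm) {W : Submodule ℂ Y}
    (hW : IsIsotropic B W) {x : Y} (hx : x ∈ B.orthogonal W) (hxx : B x x = 0) :
    IsIsotropic B (W ⊔ Submodule.span ℂ {x}) := by
  intro y hy z hz
  obtain ⟨w, hw, _, hs, rfl⟩ := Submodule.mem_sup.mp hy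
  obtain ⟨s, rfl⟩ := Submodule.mem_span_singleton.mp hs
  obtain ⟨w', hw', _, hs', rfl⟩ := Submodule.mem_sup.mp hz
  obtain ⟨s', rfl⟩ := Submodule.mem_span_singleton.mp hs'
  have h1 : B w x = 0 := hx w hw
  have h2 : B x w' = 0 := by rw [hsymm.eq]; exact hx w' hw'
  simp [hW w hw w' hw', h1, h2, hxx]

/-- On a plane spanned by `x` and `y`, the form restricted to the line `x + t y` is a quadratic
polynomial in `t`, which has a complex root. -/
theorem exists_isotropic_vector (hsymm : B.IsSymm) {C : Submodule ℂ Y} (hC : 2 ≤ finrank ℂ C) :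
    ∃ x ∈ C, x ≠ 0 ∧ B x x = 0 := by
  have : Module.Finite ℂ C := Module.finite_of_finrank_pos (by omega)
  let b := Module.finBasis ℂ C
  have hli := (b.linearIndependent.map' C.subtype C.ker_subtype).comp
    ![(⟨0, by omega⟩ : Fin (finrank ℂ C)), ⟨1, by omega⟩] (by
      intro i j; fin_cases i <;> fin_cases j <;> simp)
  set x : Y := ((b ⟨0, by omega⟩ : C) : Y) with hx
  set y : Y := ((b ⟨1, by omega⟩ : C) : Y) with hy
  have hxC : x ∈ C := Subtype.property _
  have hyC : y ∈ C := Subtype.property _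
  have hxy : LinearIndependent ℂ ![x, y] := by
    have e : ![x, y] = (C.subtype ∘ b) ∘ ![(⟨0, by omega⟩ : Fin (finrank ℂ C)), ⟨1, by omega⟩] := by
      ext i; fin_cases i <;> rfl
    rw [e]
    exact hli
  rw [LinearIndependent.pair_iff] at hxy
  by_cases hyy : B y y = 0
  · refine ⟨y, hyC, fun h => ?_, hyy⟩
    simpa using hxy 0 1 (by simp [h])
  · obtain ⟨s, hs⟩ := IsAlgClosed.exists_pow_nat_eq
      (discrim (B y y) (2 * B x y) (B x x)) two_pos
    obtain ⟨t, ht⟩ := exists_quadratic_eq_zero hyy ⟨s, by rw [← hs, sq]⟩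
    refine ⟨x + t • y, C.add_mem hxC (C.smul_mem _ hyC), fun h => ?_, ?_⟩
    · simpa using (hxy 1 t (by simpa using h)).1
    · have : B y x = B x y := hsymm.eq _ _
      simp only [map_add, LinearMap.add_apply, map_smul, LinearMap.smul_apply, smul_eq_mul, this]
      linear_combination ht

variable [FiniteDimensional ℂ Y]

theorem IsIsotropic.two_mul_finrank_le (hnd : B.Nondegenerate) {W : Submodule ℂ Y}
    (hW : IsIsotropic B W) : 2 * finrank ℂ W ≤ finrank ℂ Y := by
  have h1 := Submodule.finrank_mono (isIsotropic_iff_le_orthogonal.mp hW)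
  have h2 := LinearMap.BilinForm.finrank_orthogonal hnd W
  have h3 := W.finrank_le
  omega

theorem maximal_isIsotropic_of_finrank (hnd : B.Nondegenerate) {W : Submodule ℂ Y}
    (hW : IsIsotropic B W) (hd : 2 * finrank ℂ W = finrank ℂ Y) : Maximal (IsIsotropic B) W := by
  refine ⟨hW, fun W' hW' hle => ?_⟩
  have := hW'.two_mul_finrank_le hnd
  exact (Submodule.eq_of_le_of_finrank_le hle (by omega)).ge

/-- A maximal isotropic subspace `W` is half-dimensional: otherwise a complement of `W` in its
orthogonal has dimension at least two, and an isotropic vector in it can be added to `W`. -/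
theorem two_mul_finrank_of_maximal (hsymm : B.IsSymm) (hnd : B.Nondegenerate)
    (hdim : Even (finrank ℂ Y)) {W : Submodule ℂ Y} (hW : Maximal (IsIsotropic B) W) :
    2 * finrank ℂ W = finrank ℂ Y := by
  obtain ⟨n, hn⟩ := hdim
  refine le_antisymm (hW.prop.two_mul_finrank_le hnd) (not_lt.mp fun hlt => ?_)
  have hle := isIsotropic_iff_le_orthogonal.mp hW.prop
  obtain ⟨C, hC⟩ := Submodule.exists_isCompl (W.submoduleOf (B.orthogonal W))
  have h1 := Submodule.finrank_add_eq_of_isCompl hC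
  rw [(Submodule.submoduleOfEquivOfLe hle).finrank_eq,
    LinearMap.BilinForm.finrank_orthogonal hnd] at h1
  have h2 : finrank ℂ (C.map (B.orthogonal W).subtype) = finrank ℂ C :=
    Submodule.finrank_map_subtype_eq _ _
  obtain ⟨x, hx, hx0, hxx⟩ := exists_isotropic_vector hsymm
    (C := C.map (B.orthogonal W).subtype) (by omega)
  obtain ⟨⟨x, hxW⟩, hxC, rfl⟩ := hx
  have hmem : x ∈ W := hW.le_of_ge (hW.prop.sup_span_singleton hsymm hxW hxx) le_sup_left
    (Submodule.mem_sup_right (Submodule.mem_span_singleton_self x))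
  have := Submodule.disjoint_def.mp hC.disjoint ⟨x, hxW⟩ hmem hxC
  exact hx0 (by simp [this])

theorem orthogonal_eq_of_finrank (hnd : B.Nondegenerate) {W : Submodule ℂ Y}
    (hW : IsIsotropic B W) (hd : 2 * finrank ℂ W = finrank ℂ Y) : B.orthogonal W = W := by
  have h2 := LinearMap.BilinForm.finrank_orthogonal hnd W
  exact (Submodule.eq_of_le_of_finrank_le (isIsotropic_iff_le_orthogonal.mp hW) (by omega)).symm

theorem mem_span_of_forall_orthogonal (hnd : B.Nondegenerate) {ν : Type*} [Fintype ν] {w : ν → Y}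
    (hw : LinearIndependent ℂ w) (hww : ∀ i j, B (w i) (w j) = 0)
    (hcard : 2 * Fintype.card ν = finrank ℂ Y) {y : Y} (hy : ∀ i, B (w i) y = 0) :
    y ∈ Submodule.span ℂ (Set.range w) := by
  rw [← orthogonal_eq_of_finrank hnd (isIsotropic_span hww)
    (by rw [finrank_span_eq_card hw, hcard])]
  intro x hx
  change B x y = 0
  induction hx using Submodule.span_induction with
  | mem x hx => obtain ⟨i, rfl⟩ := hx; exact hy i
  | zero => simp
  | add _ _ _ _ h1 h2 => simp [h1, h2]
  | smul _ _ _ h => simp [h]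

theorem IsIsotropic.exists_le_maximal {W : Submodule ℂ Y} (hW : IsIsotropic B W) :
    ∃ W', W ≤ W' ∧ Maximal (IsIsotropic B) W' :=
  exists_maximal_ge_of_wellFoundedGT (IsIsotropic B) W hW

/-- Coordinates in which the form is the complex-bilinear dot product. -/
theorem exists_equiv_dotProduct (hsymm : B.IsSymm) (hnd : B.Nondegenerate) {n : Type*} [Fintype n]
    (hn : Fintype.card n = finrank ℂ Y) :
    ∃ e : Y ≃ₗ[ℂ] (n → ℂ), ∀ x y, B x y = e x ⬝ᵥ e y := by
  have hassoc : QuadraticMap.associated (R := ℂ) (LinearMap.BilinMap.toQuadraticMap B) = B :=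
    QuadraticMap.associated_left_inverse ℂ hsymm.eq
  obtain ⟨f⟩ := QuadraticForm.equivalent_weightedSumSquares_of_isAlgClosed
    (LinearMap.BilinMap.toQuadraticMap B) (by rw [hassoc]; exact hnd.1)
  let σ : n ≃ Fin (finrank ℂ Y) := Fintype.equivFinOfCardEq hn
  refine ⟨f.toLinearEquiv.trans (LinearEquiv.funCongrLeft ℂ ℂ σ), fun x y => ?_⟩
  have hq : ∀ z, B z z = f z ⬝ᵥ f z := by
    intro z
    have := f.map_app z
    simp only [QuadraticMap.weightedSumSquares_apply,
      LinearMap.BilinMap.toQuadraticMap_apply] at this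
    rw [← this]
    simp [dotProduct]
  have h1 := hq (x + y)
  have h2 : B y x = B x y := hsymm.eq _ _
  have h3 : f (x + y) = f x + f y := map_add f.toLinearEquiv x y
  rw [h3] at h1
  simp only [map_add, LinearMap.add_apply, dotProduct_add, add_dotProduct, hq, h2] at h1
  rw [dotProduct_comm (f y) (f x)] at h1
  have h4 : B x y = f x ⬝ᵥ f y := by linear_combination h1 / 2
  rw [h4]
  exact (Equiv.sum_comp σ fun i => f x i * f y i).symm

end Isotropic

/-! ### Frames adapted to a pair of isotropic subspaces -/

section Hyperbolic

open Matrix Module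

variable {Y : Type*} [AddCommGroup Y] [Module ℂ Y] {B : LinearMap.BilinForm ℂ Y}

/-- `k` is a basis of an isotropic subspace orthogonal to all `a i` and `b i`, and the families `a`
and `b` are isotropic and dual to each other. So `(k, a)` and `(k, b)` are frames of two isotropic
subspaces, whose intersection is spanned by `k`. The independence of `a` and `b` is not asked for,
as it follows from their duality. -/
structure IsHyperbolicFrame (B : LinearMap.BilinForm ℂ Y) {κ ι : Type*} [DecidableEq ι]
    (k : κ → Y) (a b : ι → Y) : Prop where
  linearIndependent : LinearIndependent ℂ k
  kk : ∀ i j, B (k i) (k j) = 0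
  ka : ∀ i j, B (k i) (a j) = 0
  kb : ∀ i j, B (k i) (b j) = 0
  aa : ∀ i j, B (a i) (a j) = 0
  bb : ∀ i j, B (b i) (b j) = 0
  ab : ∀ i j, B (a i) (b j) = if i = j then 1 else 0

namespace IsHyperbolicFrame

variable {κ ι : Type*} [DecidableEq ι] {k : κ → Y} {a b : ι → Y}

theorem symm (hsymm : B.IsSymm) (h : IsHyperbolicFrame B k a b) : IsHyperbolicFrame B k b a where
  linearIndependent := h.linearIndependent
  kk := h.kk
  ka := h.kb
  kb := h.ka
  aa := h.bb
  bb := h.aa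
  ab i j := by rw [hsymm.eq, h.ab]; simp [eq_comm]

theorem reindex {ι' : Type*} [DecidableEq ι'] (h : IsHyperbolicFrame B k a b) (σ : ι' ≃ ι) :
    IsHyperbolicFrame B k (a ∘ σ) (b ∘ σ) where
  linearIndependent := h.linearIndependent
  kk := h.kk
  ka i j := h.ka i _
  kb i j := h.kb i _
  aa i j := h.aa _ _
  bb i j := h.bb _ _
  ab i j := by simp [h.ab]

variable [Fintype ι]

/-- The rows of `P a + Q b`, together with `k`, are linearly independent as soon as `P` or `Q` is
invertible: pairing a relation with `b` and `a` gives the products of its coefficients with `P` and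
with `Q`. -/
theorem linearIndependent_sumElim [Fintype κ] (hsymm : B.IsSymm) (h : IsHyperbolicFrame B k a b)
    (P Q : Matrix ι ι ℂ) (hPQ : P.det ≠ 0 ∨ Q.det ≠ 0) :
    LinearIndependent ℂ (Sum.elim k fun i => ∑ j, (P i j • a j + Q i j • b j)) := by
  rw [Fintype.linearIndependent_iff]
  intro g hg
  rw [Fintype.sum_sum_type] at hg
  simp only [Sum.elim_inl, Sum.elim_inr] at hg
  have hba : ∀ i j, B (b i) (a j) = if i = j then 1 else 0 := (h.symm hsymm).ab
  have h0 : ∀ y, (∑ i, g (Sum.inl i) * B (k i) y) +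
      ∑ i, g (Sum.inr i) * ∑ j, (P i j * B (a j) y + Q i j * B (b j) y) = 0 := by
    intro y
    simpa using congrArg (fun z => B z y) hg
  have hP : (fun i => g (Sum.inr i)) ᵥ* P = 0 := by
    ext l
    simpa [h.kb, h.ab, h.bb, vecMul, dotProduct] using h0 (b l)
  have hQ : (fun i => g (Sum.inr i)) ᵥ* Q = 0 := by
    ext l
    simpa [h.ka, h.aa, hba, vecMul, dotProduct] using h0 (a l)
  have hr : (fun i => g (Sum.inr i)) = 0 :=
    hPQ.elim (fun hd => eq_zero_of_vecMul_eq_zero hd hP)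
      (fun hd => eq_zero_of_vecMul_eq_zero hd hQ)
  have hr' : ∀ i, g (Sum.inr i) = 0 := congrFun hr
  have hl := Fintype.linearIndependent_iff.mp h.linearIndependent (fun i => g (Sum.inl i))
    (by simpa [hr'] using hg)
  rintro (i | i)
  · exact hl i
  · exact hr' i

theorem linearIndependent_left [Fintype κ] (hsymm : B.IsSymm) (h : IsHyperbolicFrame B k a b) :
    LinearIndependent ℂ (Sum.elim k a) := by
  simpa [Finset.sum_add_distrib, Matrix.one_apply] using
    h.linearIndependent_sumElim hsymm 1 0 (by simp)

/-- The vectors `k` and `P a + Q b` span an isotropic subspace if `P * Qᵀ` is skew-symmetric. -/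
theorem isotropic_sumElim (hsymm : B.IsSymm) (h : IsHyperbolicFrame B k a b)
    (P Q : Matrix ι ι ℂ) (hPQ : P * Qᵀ + Q * Pᵀ = 0) (i j : κ ⊕ ι) :
    B ((Sum.elim k fun i => ∑ j, (P i j • a j + Q i j • b j)) i)
      ((Sum.elim k fun i => ∑ j, (P i j • a j + Q i j • b j)) j) = 0 := by
  have hba : ∀ i j, B (b i) (a j) = if i = j then 1 else 0 := (h.symm hsymm).ab
  have hak : ∀ i j, B (a i) (k j) = 0 := fun i j => by rw [hsymm.eq]; exact h.ka j i
  have hbk : ∀ i j, B (b i) (k j) = 0 := fun i j => by rw [hsymm.eq]; exact h.kb j i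
  rcases i with i | i <;> rcases j with j | j
  · exact h.kk i j
  · simp [h.ka, h.kb]
  · simp [hak, hbk]
  · have := congrFun (congrFun hPQ i) j
    simp only [Matrix.add_apply, Matrix.mul_apply, transpose_apply, Matrix.zero_apply,
      ← Finset.sum_add_distrib] at this
    simp only [Sum.elim_inr, map_sum, LinearMap.sum_apply, map_add, LinearMap.add_apply, map_smul,
      LinearMap.smul_apply, smul_eq_mul, h.aa, h.bb, h.ab, hba]
    refine Eq.trans ?_ this
    simp [Finset.sum_add_distrib, add_comm, mul_comm]

theorem isotropic_left (hsymm : B.IsSymm) (h : IsHyperbolicFrame B k a b) (i j : κ ⊕ ι) :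
    B (Sum.elim k a i) (Sum.elim k a j) = 0 := by
  have := h.isotropic_sumElim hsymm 1 0 (by simp) i j
  simpa [Finset.sum_add_distrib, Matrix.one_apply] using this

end IsHyperbolicFrame

theorem codimInter_add_finrank_inf [FiniteDimensional ℂ Y] (H W : Submodule ℂ Y) :
    codimInter H W + finrank ℂ (H ⊓ W : Submodule ℂ Y) = finrank ℂ H := by
  have := Submodule.finrank_quotient_add_finrank ((H ⊓ W).submoduleOf H)
  rwa [(Submodule.submoduleOfEquivOfLe (inf_le_left : H ⊓ W ≤ H)).finrank_eq] at this

/-- Two half-dimensional isotropic subspaces have frames adapted to their intersection `K`: for a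
complement `C` of `K` in `H₁`, the form identifies `H₂ / K` with the dual of `C`. -/
theorem exists_isHyperbolicFrame [FiniteDimensional ℂ Y] (hsymm : B.IsSymm) (hnd : B.Nondegenerate)
    {H₁ H₂ : Submodule ℂ Y} (h₁ : IsIsotropic B H₁) (h₂ : IsIsotropic B H₂)
    (hd₁ : 2 * finrank ℂ H₁ = finrank ℂ Y) (hd₂ : 2 * finrank ℂ H₂ = finrank ℂ Y) :
    ∃ (k : Fin (finrank ℂ (H₁ ⊓ H₂ : Submodule ℂ Y)) → Y) (a b : Fin (codimInter H₁ H₂) → Y),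
      IsHyperbolicFrame B k a b ∧ Submodule.span ℂ (Set.range (Sum.elim k a)) = H₁ ∧
      Submodule.span ℂ (Set.range (Sum.elim k b)) = H₂ := by
  set K : Submodule ℂ Y := H₁ ⊓ H₂
  have hK₁ : K ≤ H₁ := inf_le_left
  have hK₂ : K ≤ H₂ := inf_le_right
  have hcodim : codimInter H₁ H₂ + finrank ℂ K = finrank ℂ H₁ :=
    codimInter_add_finrank_inf H₁ H₂
  obtain ⟨C, hC⟩ := Submodule.exists_isCompl (K.submoduleOf H₁)
  have hCr : finrank ℂ C = codimInter H₁ H₂ := by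
    have := Submodule.finrank_add_eq_of_isCompl hC
    rw [(Submodule.submoduleOfEquivOfLe hK₁).finrank_eq] at this
    omega
  let ca := Module.finBasisOfFinrankEq ℂ C hCr
  let k := fun i => ((Module.finBasis ℂ K i : K) : Y)
  let a := fun i => ((ca i : H₁) : Y)
  have hk₁ : ∀ i, k i ∈ H₁ := fun i => (Subtype.property (Module.finBasis ℂ K i)).1
  have hk₂ : ∀ i, k i ∈ H₂ := fun i => (Subtype.property (Module.finBasis ℂ K i)).2
  have ha₁ : ∀ i, a i ∈ H₁ := fun i => Subtype.property _
  -- The pairing `H₂ → C*` is surjective because its kernel is `K`.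
  let φ : H₂ →ₗ[ℂ] Module.Dual ℂ C :=
    { toFun := fun y => (B.flip y.1).comp (H₁.subtype.comp C.subtype)
      map_add' := fun x y => by ext; simp
      map_smul' := fun c x => by ext; simp }
  have hφ : LinearMap.ker φ = K.submoduleOf H₂ := by
    ext ⟨y, hy⟩
    rw [LinearMap.mem_ker]
    constructor
    · intro h
      refine ⟨?_, hy⟩
      change y ∈ H₁
      rw [← orthogonal_eq_of_finrank hnd h₁ hd₁]
      intro x hx
      have hx' : (⟨x, hx⟩ : H₁) ∈ K.submoduleOf H₁ ⊔ C := by rw [hC.sup_eq_top]; trivial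
      obtain ⟨u, hu, w, hw, huw⟩ := Submodule.mem_sup.mp hx'
      have e1 : B u.1 y = 0 := h₂ _ hu.2 _ hy
      have e2 : B w.1 y = 0 := congrArg (fun f => f ⟨w, hw⟩) h
      have e3 : x = u.1 + w.1 := congrArg Subtype.val huw.symm
      change B x y = 0
      rw [e3, map_add, LinearMap.add_apply, e1, e2, add_zero]
    · intro h
      ext ⟨⟨w, hw⟩, hwC⟩
      exact h₁ w hw y h.1
  have hφs : Function.Surjective φ := by
    rw [← LinearMap.range_eq_top]
    apply Submodule.eq_top_of_finrank_eq
    have := φ.finrank_range_add_finrank_ker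
    rw [hφ, (Submodule.submoduleOfEquivOfLe hK₂).finrank_eq] at this
    rw [Subspace.dual_finrank_eq, hCr]
    omega
  -- `b'` lifts the basis dual to `ca`.
  choose b' hb' using fun i => hφs (ca.coord i)
  have hF : IsHyperbolicFrame B k a (fun i => (b' i : Y)) :=
    { linearIndependent := (Module.finBasis ℂ K).linearIndependent.map' K.subtype K.ker_subtype
      kk := fun i j => h₁ _ (hk₁ i) _ (hk₁ j)
      ka := fun i j => h₁ _ (hk₁ i) _ (ha₁ j)
      kb := fun i j => h₂ _ (hk₂ i) _ (b' j).2
      aa := fun i j => h₁ _ (ha₁ i) _ (ha₁ j)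
      bb := fun i j => h₂ _ (b' i).2 _ (b' j).2
      ab := fun i j => by
        have := congrArg (fun f => f (ca i)) (hb' j)
        simpa [φ, Finsupp.single_apply] using this }
  refine ⟨k, a, fun i => (b' i : Y), hF, ?_, ?_⟩
  · apply Submodule.eq_of_le_of_finrank_eq
    · rw [Submodule.span_le, Set.range_subset_iff]
      rintro (i | i)
      · exact hk₁ i
      · exact ha₁ i
    · rw [finrank_span_eq_card (hF.linearIndependent_left hsymm)]
      simp; omega
  · apply Submodule.eq_of_le_of_finrank_eq
    · rw [Submodule.span_le, Set.range_subset_iff]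
      rintro (i | i)
      · exact hk₂ i
      · exact (b' i).2
    · rw [finrank_span_eq_card ((hF.symm hsymm).linearIndependent_left hsymm)]
      simp; omega

end Hyperbolic

/-! ### The phase of a subspace -/

section SubspacePhase

open Matrix Module

open scoped ComplexOrder

variable {Y : Type*} [AddCommGroup Y] [Module ℂ Y]

/-- The matrix whose columns are the coordinates of the vectors of a family. -/
def frameCoords {ι : Type*} (e : Y ≃ₗ[ℂ] (ι ⊕ ι → ℂ)) (v : ι → Y) : Matrix (ι ⊕ ι) ι ℂ :=
  Matrix.of fun x j => e (v j) x

variable {ι : Type*} [Fintype ι] (e : Y ≃ₗ[ℂ] (ι ⊕ ι → ℂ))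

theorem mulVec_frameCoords (v : ι → Y) (c : ι → ℂ) :
    frameCoords e v *ᵥ c = e (∑ j, c j • v j) := by
  ext x
  simp [frameCoords, mulVec, dotProduct, mul_comm]

theorem transpose_mul_frameCoords {e : Y ≃ₗ[ℂ] (ι ⊕ ι → ℂ)} {B : LinearMap.BilinForm ℂ Y}
    (hB : ∀ x y, B x y = e x ⬝ᵥ e y) {v : ι → Y}
    (hv : ∀ i j, B (v i) (v j) = 0) :
    (frameCoords e v)ᵀ * frameCoords e v = 0 := by
  ext i j
  simpa [hB, dotProduct, frameCoords, Matrix.mul_apply] using hv i j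

theorem mulVec_frameCoords_injective {v : ι → Y} (hv : LinearIndependent ℂ v) :
    Function.Injective (frameCoords e v).mulVec := by
  refine (injective_iff_map_eq_zero (frameCoords e v).mulVecLin).2 fun c hc => ?_
  rw [mulVecLin_apply, mulVec_frameCoords, e.map_eq_zero_iff] at hc
  exact funext (Fintype.linearIndependent_iff.mp hv c hc)

theorem gram_posDef {v : ι → Y} (hv : LinearIndependent ℂ v) :
    ((frameCoords e v)ᴴ * frameCoords e v).PosDef :=
  .conjTranspose_mul_self _ (mulVec_frameCoords_injective e hv)

variable [DecidableEq ι]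

theorem gram_det_ne_zero {v : ι → Y} (hv : LinearIndependent ℂ v) :
    ((frameCoords e v)ᴴ * frameCoords e v).det ≠ 0 :=
  (gram_posDef e hv).det_pos.ne'

theorem linearIndependent_of_gram_det_ne_zero {v : ι → Y}
    (h : ((frameCoords e v)ᴴ * frameCoords e v).det ≠ 0) : LinearIndependent ℂ v := by
  rw [Fintype.linearIndependent_iff]
  intro c hc
  have h1 : frameCoords e v *ᵥ c = 0 := by rw [mulVec_frameCoords, hc, map_zero]
  exact congrFun (eq_zero_of_mulVec_eq_zero h (by rw [← mulVec_mulVec, h1, mulVec_zero]))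

theorem phase_eq_of_span_eq {v w : ι → Y} (hw : LinearIndependent ℂ w)
    (h : Submodule.span ℂ (Set.range v) = Submodule.span ℂ (Set.range w)) :
    phase (frameCoords e w) = phase (frameCoords e v) := by
  have hmem : ∀ j, ∃ c : ι → ℂ, ∑ i, c i • v i = w j := fun j =>
    (Submodule.mem_span_range_iff_exists_fun ℂ).mp (h ▸ Submodule.subset_span ⟨j, rfl⟩)
  choose c hc using hmem
  have hP : frameCoords e w = frameCoords e v * Matrix.of fun i j => c j i := by
    ext x j
    simp [frameCoords, Matrix.mul_apply, ← hc j, mul_comm]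
  have hd := gram_det_ne_zero e hw
  rw [hP, conjTranspose_mul, Matrix.mul_assoc, ← Matrix.mul_assoc _ _ (Matrix.of _), det_mul,
    det_mul] at hd
  rw [hP, phase_mul _ (right_ne_zero_of_mul (right_ne_zero_of_mul hd))]

open Classical in
/-- The phase of a subspace of half the dimension, computed with any of its frames; by convention
`0` for subspaces of other dimensions. -/
noncomputable def subspacePhase (W : Submodule ℂ Y) : ℂ :=
  if h : ∃ v : ι → Y, LinearIndependent ℂ v ∧ Submodule.span ℂ (Set.range v) = W then
    phase (frameCoords e h.choose) else 0

theorem subspacePhase_span {v : ι → Y} (hv : LinearIndependent ℂ v) :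
    subspacePhase e (Submodule.span ℂ (Set.range v)) = phase (frameCoords e v) := by
  have h : ∃ w : ι → Y, LinearIndependent ℂ w ∧
    Submodule.span ℂ (Set.range w) = Submodule.span ℂ (Set.range v) := ⟨v, hv, rfl⟩
  rw [subspacePhase, dif_pos h]
  exact (phase_eq_of_span_eq e hv h.choose_spec.2).symm

/-- The phase is continuous on the whole Grassmannian, isotropy playing no part: on the component
of the half-dimensional subspaces it is induced by a continuous function of the frame, and on the
others it vanishes. -/
theorem continuous_subspacePhase [TopologicalSpace Y] [IsTopologicalAddGroup Y]
    [ContinuousSMul ℂ Y] [T2Space Y] [FiniteDimensional ℂ Y] {m : ℕ}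
    (e : Y ≃ₗ[ℂ] (Fin m ⊕ Fin m → ℂ)) :
    @Continuous _ _ (grassmannianTopology Y) _ (subspacePhase e) := by
  rw [continuous_coinduced_dom, continuous_sigma_iff]
  intro k
  by_cases hk : k = m
  · subst hk
    have he : Continuous e := LinearMap.continuous_of_finiteDimensional e.toLinearMap
    have hA : Continuous fun v : Frames Y k => frameCoords e v.1 := by
      refine continuous_matrix fun x j => ?_
      exact (continuous_apply x).comp (he.comp ((continuous_apply j).comp continuous_subtype_val))
    have hA' : Continuous fun v : Frames Y k => (frameCoords e v.1).map star :=
      hA.matrix_map continuous_star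
    have hX : Continuous fun v : Frames Y k =>
        fromCols (frameCoords e v.1) ((frameCoords e v.1).map star) := by
      refine continuous_matrix fun x j => ?_
      rcases j with j | j
      · exact hA.matrix_elem x j
      · exact hA'.matrix_elem x j
    have : Continuous fun v : Frames Y k => phase (frameCoords e v.1) :=
      hX.matrix_det.div (hA.matrix_conjTranspose.matrix_mul hA).matrix_det
        fun v => gram_det_ne_zero e v.2
    exact this.congr fun v => (subspacePhase_span e v.2).symm
  · refine continuous_const (y := (0 : ℂ)) |>.congr fun v => ?_
    symm
    refine dif_neg ?_
    rintro ⟨w, hw, hwv⟩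
    have h1 := finrank_span_eq_card hw
    have h2 := finrank_span_eq_card v.2
    rw [hwv] at h1
    rw [Fintype.card_fin] at h1 h2
    exact hk (h2.symm.trans h1)

/-- Two half-dimensional isotropic subspaces meeting in a hyperplane of each have opposite phases. A
vector of the first one, Hermitian orthogonal to the intersection, has its conjugate in the second
one, so `phase_updateCol_star` applies. -/
theorem subspacePhase_update [FiniteDimensional ℂ Y] {e : Y ≃ₗ[ℂ] (ι ⊕ ι → ℂ)}
    {B : LinearMap.BilinForm ℂ Y} (hB : ∀ x y, B x y = e x ⬝ᵥ e y) (hsymm : B.IsSymm)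
    (hnd : B.Nondegenerate) {v : ι → Y} (hv : LinearIndependent ℂ v)
    (hvv : ∀ i j, B (v i) (v j) = 0) (i₀ : ι) {b : Y}
    (hb : LinearIndependent ℂ (Function.update v i₀ b)) (hbb : B b b = 0)
    (hvb : ∀ j, j ≠ i₀ → B (v j) b = 0)
    (hvb₀ : B (v i₀) b = 1) :
    subspacePhase e (Submodule.span ℂ (Set.range (Function.update v i₀ b))) =
      -subspacePhase e (Submodule.span ℂ (Set.range v)) := by
  have hcard : 2 * Fintype.card ι = finrank ℂ Y := by
    rw [e.finrank_eq]; simp; ring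
  set A := frameCoords e v with hA
  set G := Aᴴ * A with hG
  have hGpos : G.PosDef := gram_posDef e hv
  -- `A *ᵥ c` lies in the first subspace, is Hermitian orthogonal to the `v j` with `j ≠ i₀`, and
  -- has Hermitian product `1` with `v i₀`.
  set c := G⁻¹ *ᵥ Pi.single i₀ 1 with hc
  have hGc : G *ᵥ c = Pi.single i₀ 1 := by
    rw [hc, mulVec_mulVec, mul_nonsing_inv _ (isUnit_iff_ne_zero.mpr hGpos.det_pos.ne'), one_mulVec]
  have hc0 : c i₀ ≠ 0 := by
    have : c i₀ = G⁻¹ i₀ i₀ := by simp [hc]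
    rw [this]
    exact hGpos.inv.diag_pos.ne'
  set P : Matrix ι ι ℂ := (1 : Matrix ι ι ℂ).updateCol i₀ c with hP
  have hPdet : P.det ≠ 0 := by
    rw [hP, ← cramer_apply, cramer_one]
    exact hc0
  have hAP : A * P = A.updateCol i₀ (A *ᵥ c) := by
    ext x j
    by_cases h : j = i₀
    · subst h; simp [hP, Matrix.mul_apply, mulVec, dotProduct]
    · simp [hP, Matrix.mul_apply, h, Matrix.one_apply]
  have hAA : Aᵀ * A = 0 := transpose_mul_frameCoords hB hvv
  have hAP0 : (A * P)ᵀ * (A * P) = 0 := by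
    rw [transpose_mul, Matrix.mul_assoc, ← Matrix.mul_assoc Aᵀ, hAA]; simp
  have horth : ∀ j, j ≠ i₀ → ((A * P)ᴴ * (A * P)) i₀ j = 0 := by
    intro j hj
    have h1 : ((A * P)ᴴ * (A * P)) j i₀ = (Aᴴ *ᵥ (A *ᵥ c)) j := by
      rw [hAP]
      simp [Matrix.mul_apply, mulVec, dotProduct, hj]
    rw [mulVec_mulVec, ← hG, hGc, Pi.single_eq_of_ne hj] at h1
    have h2 := congrArg star h1
    rw [← conjTranspose_apply, conjTranspose_mul, conjTranspose_conjTranspose] at h2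
    simpa using h2
  obtain ⟨hgram, hphase⟩ := phase_updateCol_star hAP0 i₀ horth
  -- `a` is the conjugate of the vector with coordinates `A *ᵥ c`.
  set a := e.symm (star (A *ᵥ c)) with ha
  have hea : e a = star (A *ᵥ c) := by simp [ha]
  have hB' : (A * P).updateCol i₀ (fun x => star ((A * P) x i₀))
      = frameCoords e (Function.update v i₀ a) := by
    rw [hAP]
    ext x j
    by_cases h : j = i₀
    · subst h; simp [frameCoords, hea]
    · simp [frameCoords, h, hA]
  rw [hB'] at hgram hphase
  have hali : LinearIndependent ℂ (Function.update v i₀ a) := by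
    apply linearIndependent_of_gram_det_ne_zero e
    rw [hgram, conjTranspose_mul, Matrix.mul_assoc, ← Matrix.mul_assoc Aᴴ, det_mul, det_mul,
      det_conjTranspose]
    exact mul_ne_zero (star_ne_zero.mpr hPdet) (mul_ne_zero hGpos.det_pos.ne' hPdet)
  have hav : ∀ j, B a (v j) = (Pi.single i₀ 1 : ι → ℂ) j := by
    intro j
    have h1 : (Aᴴ *ᵥ (A *ᵥ c)) j = (Pi.single i₀ 1 : ι → ℂ) j := by
      rw [mulVec_mulVec, ← hG, hGc]
    have h2 := congrArg star h1
    have h3 : star ((Pi.single i₀ 1 : ι → ℂ) j) = (Pi.single i₀ 1 : ι → ℂ) j := by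
      by_cases h : j = i₀
      · subst h; simp
      · simp [h]
    rw [h3] at h2
    rw [← h2, hB, hea]
    simp [mulVec, dotProduct, hA, frameCoords, mul_comm]
  have haa : B a a = 0 := by
    have h2 : (A *ᵥ c) ⬝ᵥ (A *ᵥ c) = 0 := by
      rw [dotProduct_mulVec, ← mulVec_transpose, mulVec_mulVec, hAA]; simp
    rw [hB, hea]
    have := congrArg star h2
    simpa [dotProduct] using this
  have hbv : ∀ i j, B (Function.update v i₀ b i) (Function.update v i₀ b j) = 0 := by
    intro i j
    by_cases hi : i = i₀ <;> by_cases hj : j = i₀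
    · subst hi; subst hj; simpa using hbb
    · subst hi; simp only [Function.update_self, Function.update_of_ne hj]
      rw [hsymm.eq]; exact hvb j hj
    · subst hj; simp only [Function.update_self, Function.update_of_ne hi]
      exact hvb i hi
    · simp [hi, hj, hvv]
  have hperp {w : ι → Y} (hw : LinearIndependent ℂ w) (hww : ∀ i j, B (w i) (w j) = 0) (y : Y)
      (hy : ∀ i, B (w i) y = 0) : y ∈ Submodule.span ℂ (Set.range w) :=
    mem_span_of_forall_orthogonal hnd hw hww hcard hy
  have hva : ∀ j, B (v j) a = (Pi.single i₀ 1 : ι → ℂ) j := fun j => by rw [hsymm.eq, hav]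
  -- The vector `x = a - B(a, b) v i₀ - b` is orthogonal to `v` and to `b`. It is therefore in the
  -- first subspace, so isotropic, and then `0 = B(a, x) = - 2 B(a, b)`.
  have hab : B a b = 0 := by
    set α := B a b with hα
    set x := a - α • v i₀ - b with hx
    have hxv : ∀ i, B (v i) x = 0 := by
      intro i
      by_cases hi : i = i₀
      · subst hi; simp [hx, hva, hvv, hvb₀]
      · simp [hx, hva, hvv, hvb i hi, hi]
    have hxx : B x x = 0 :=
      isIsotropic_span hvv _ (hperp hv hvv x hxv) _ (hperp hv hvv x hxv)
    have hbx : B b x = 0 := by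
      have h1 : B b a = α := hsymm.eq _ _
      have h2 : B b (v i₀) = 1 := by rw [hsymm.eq]; exact hvb₀
      simp [hx, h1, h2, hbb]
    have h1 : B a x = 0 := by
      have : a = x + α • v i₀ + b := by rw [hx]; abel
      rw [this]
      simp [hxx, hxv, hbx]
    have h2 : B a x = -α - α := by
      simp [hx, haa, hav, ← hα]
    have h3 : 2 * α = 0 := by linear_combination h2 - h1
    simpa using h3
  have hspan : Submodule.span ℂ (Set.range (Function.update v i₀ a)) =
      Submodule.span ℂ (Set.range (Function.update v i₀ b)) := by
    apply Submodule.eq_of_le_of_finrank_eq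
    · rw [Submodule.span_le, Set.range_subset_iff]
      intro i
      by_cases hi : i = i₀
      · subst hi
        rw [Function.update_self]
        refine hperp hb hbv a fun j => ?_
        by_cases hj : j = i
        · subst hj; rw [Function.update_self, hsymm.eq]; exact hab
        · simp [hj, hva]
      · refine Submodule.subset_span ⟨i, ?_⟩
        simp [hi]
    · rw [finrank_span_eq_card hali, finrank_span_eq_card hb]
  rw [← hspan, subspacePhase_span e hali, subspacePhase_span e hv, hphase, phase_mul _ hPdet]

end SubspacePhase

/-! ### Connected components of the isotropic Grassmannian -/

namespace IsHyperbolicFrame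

open Matrix Module

variable {Y : Type*} [AddCommGroup Y] [Module ℂ Y] {B : LinearMap.BilinForm ℂ Y}
  {κ ι : Type*} [Fintype κ] [Fintype ι] [DecidableEq ι]

/-- Exchanging one vector of `a` for its partner in `b`, which joins `k`. -/
theorem absorb_unit (hsymm : B.IsSymm) {k : κ → Y} {a b : Unit ⊕ ι → Y}
    (h : IsHyperbolicFrame B k a b) :
    IsHyperbolicFrame B (Sum.elim k fun u : Unit => b (Sum.inl u)) (a ∘ Sum.inr) (b ∘ Sum.inr) where
  linearIndependent := by
    have := ((h.symm hsymm).linearIndependent_left hsymm).comp (Sum.map id Sum.inl)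
      (Function.injective_id.sumMap Sum.inl_injective)
    convert this using 1
    ext (i | i) <;> rfl
  kk := by
    have hbk : ∀ i j, B (b i) (k j) = 0 := fun i j => by rw [hsymm.eq]; exact h.kb j i
    rintro (i | i) (j | j) <;> simp [h.kk, h.kb, h.bb, hbk]
  ka := by
    have hba : ∀ i j, B (b i) (a j) = if i = j then 1 else 0 := (h.symm hsymm).ab
    rintro (i | i) j <;> simp [h.ka, hba]
  kb := by rintro (i | i) j <;> simp [h.kb, h.bb]
  aa i j := h.aa _ _
  bb i j := h.bb _ _
  ab i j := by simp [h.ab]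

/-- The exchange of a single vector changes the sign of the phase. -/
theorem subspacePhase_absorb_unit [FiniteDimensional ℂ Y] (hsymm : B.IsSymm) (hnd : B.Nondegenerate)
    {m : ℕ} {e : Y ≃ₗ[ℂ] (Fin m ⊕ Fin m → ℂ)} (hB : ∀ x y, B x y = e x ⬝ᵥ e y)
    {k : κ → Y} {a b : Unit ⊕ ι → Y} (h : IsHyperbolicFrame B k a b)
    (hcard : Fintype.card (κ ⊕ (Unit ⊕ ι)) = m) :
    subspacePhase e (Submodule.span ℂ (Set.range
        (Sum.elim (Sum.elim k fun u : Unit => b (Sum.inl u)) (a ∘ Sum.inr)))) =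
      -subspacePhase e (Submodule.span ℂ (Set.range (Sum.elim k a))) := by
  let δ : κ ⊕ (Unit ⊕ ι) ≃ Fin m := Fintype.equivFinOfCardEq hcard
  let v : Fin m → Y := Sum.elim k a ∘ δ.symm
  let i₀ : Fin m := δ (Sum.inr (Sum.inl ()))
  have hupd : Function.update v i₀ (b (Sum.inl ())) =
      Sum.elim (Sum.elim k fun u : Unit => b (Sum.inl u)) (a ∘ Sum.inr) ∘
        (δ.symm.trans (Equiv.sumAssoc κ Unit ι).symm) := by
    ext j
    obtain ⟨j, rfl⟩ := δ.surjective j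
    rcases j with j | u | j
    · rw [Function.update_of_ne (by simp [i₀])]
      simp [v]
    · simp [i₀]
    · rw [Function.update_of_ne (by simp [i₀])]
      simp [v]
  have hv : LinearIndependent ℂ v :=
    (h.linearIndependent_left hsymm).comp _ δ.symm.injective
  have hb : LinearIndependent ℂ (Function.update v i₀ (b (Sum.inl ()))) := by
    rw [hupd]
    exact ((h.absorb_unit hsymm).linearIndependent_left hsymm).comp _ (Equiv.injective _)
  have key := subspacePhase_update hB hsymm hnd hv
    (fun i j => h.isotropic_left hsymm _ _) i₀ hb (h.bb _ _)
    (fun j hj => by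
      obtain ⟨j, rfl⟩ := δ.surjective j
      rcases j with j | u | j
      · simp [v, h.kb]
      · exact absurd rfl hj
      · simp [v, h.ab])
    (by simp [v, i₀, h.ab])
  rwa [hupd, EquivLike.range_comp, EquivLike.range_comp] at key

end IsHyperbolicFrame

section Components

open Matrix Module

variable {Y : Type*} [AddCommGroup Y] [Module ℂ Y] [FiniteDimensional ℂ Y]
  {B : LinearMap.BilinForm ℂ Y}

/-- The point of the isotropic Grassmannian given by an isotropic frame of half the dimension,
indexed by any finite type. -/
def isotropicSpan (hnd : B.Nondegenerate) {ν : Type*} [Fintype ν] (w : ν → Y)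
    (hw : LinearIndependent ℂ w) (hww : ∀ i j, B (w i) (w j) = 0)
    (hcard : 2 * Fintype.card ν = finrank ℂ Y) : IsotropicGrassmannian B :=
  ⟨Submodule.span ℂ (Set.range w), maximal_isIsotropic_of_finrank hnd (isIsotropic_span hww)
    (by rw [finrank_span_eq_card hw, hcard])⟩

theorem continuous_isotropicSpan [TopologicalSpace Y] (hnd : B.Nondegenerate) {T ν : Type*}
    [TopologicalSpace T] [Fintype ν] {w : T → ν → Y} (hc : Continuous w)
    (hw : ∀ t, LinearIndependent ℂ (w t)) (hww : ∀ t i j, B (w t i) (w t j) = 0)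
    (hcard : 2 * Fintype.card ν = finrank ℂ Y) :
    Continuous fun t => isotropicSpan hnd (w t) (hw t) (hww t) hcard := by
  let δ := Fintype.equivFin ν
  have h1 : Continuous fun t => (⟨Fintype.card ν, w t ∘ δ.symm, (hw t).comp _ δ.symm.injective⟩ :
      Σ k : ℕ, Frames Y k) := by
    refine continuous_sigmaMk.comp (Continuous.subtype_mk ?_ _)
    exact continuous_pi fun i => (continuous_apply (δ.symm i)).comp hc
  let : TopologicalSpace (Submodule ℂ Y) := grassmannianTopology Y
  refine continuous_induced_rng.mpr ?_
  refine (continuous_coinduced_rng.comp h1).congr fun t => ?_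
  change Submodule.span ℂ (Set.range (w t ∘ δ.symm)) = Submodule.span ℂ (Set.range (w t))
  rw [EquivLike.range_comp]

/-- If the families `a` and `b` have an even number of elements there is an invertible
skew-symmetric matrix `J` of that size, and `(k, (1 - t) a + t J b)`, `t ∈ ℂ`, is a continuous
family of isotropic frames joining `(k, a)` to a frame of the span of `(k, b)`. -/
theorem connectedComponent_eq_of_even [TopologicalSpace Y] [IsTopologicalAddGroup Y]
    [ContinuousSMul ℂ Y] (hsymm : B.IsSymm) (hnd : B.Nondegenerate)
    {κ ι : Type*} [Fintype κ] [Fintype ι] [DecidableEq ι] {k : κ → Y} {a b : ι ⊕ ι → Y}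
    (h : IsHyperbolicFrame B k a b) (hcard : 2 * Fintype.card (κ ⊕ (ι ⊕ ι)) = finrank ℂ Y)
    {H₁ H₂ : IsotropicGrassmannian B} (h₁ : Submodule.span ℂ (Set.range (Sum.elim k a)) = H₁.1)
    (h₂ : Submodule.span ℂ (Set.range (Sum.elim k b)) = H₂.1) :
    connectedComponent H₁ = connectedComponent H₂ := by
  let P : ℂ → Matrix (ι ⊕ ι) (ι ⊕ ι) ℂ := fun t => (1 - t) • 1
  let Q : ℂ → Matrix (ι ⊕ ι) (ι ⊕ ι) ℂ := fun t => t • Matrix.J ι ℂ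
  have hJ : (Matrix.J ι ℂ).det ≠ 0 := (Matrix.isUnit_det_J ι ℂ).ne_zero
  have hPQ : ∀ t, P t * (Q t)ᵀ + Q t * (P t)ᵀ = 0 := by
    intro t
    simp [P, Q, Matrix.J_transpose, smul_smul, mul_comm]
  have hdet : ∀ t, (P t).det ≠ 0 ∨ (Q t).det ≠ 0 := by
    intro t
    by_cases ht : t = 1
    · right; subst ht; simpa [Q] using hJ
    · left
      simp only [P, det_smul, det_one, mul_one]
      exact pow_ne_zero _ (sub_ne_zero.mpr (Ne.symm ht))
  let w : ℂ → κ ⊕ (ι ⊕ ι) → Y := fun t =>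
    Sum.elim k fun i => ∑ j, (P t i j • a j + Q t i j • b j)
  have hw : Continuous w := by
    refine continuous_pi fun i => ?_
    rcases i with i | i
    · exact continuous_const
    · simp only [w, P, Q, Sum.elim_inr, Matrix.smul_apply, smul_eq_mul]
      fun_prop
  have hli : ∀ t, LinearIndependent ℂ (w t) :=
    fun t => h.linearIndependent_sumElim hsymm (P t) (Q t) (hdet t)
  let γ : ℂ → IsotropicGrassmannian B := fun t =>
    isotropicSpan hnd (w t) (hli t) (h.isotropic_sumElim hsymm (P t) (Q t) (hPQ t)) hcard
  have hγ : Continuous γ := continuous_isotropicSpan hnd hw hli _ hcard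
  have hγ0 : γ 0 = H₁ := by
    apply Subtype.ext
    rw [← h₁]
    simp [γ, isotropicSpan, w, P, Q, Finset.sum_add_distrib, Matrix.one_apply]
  have hγ1 : γ 1 = H₂ := by
    apply Subtype.ext
    rw [← h₂]
    apply Submodule.eq_of_le_of_finrank_eq
    · change Submodule.span ℂ (Set.range (w 1)) ≤ _
      rw [Submodule.span_le, Set.range_subset_iff]
      have hmem : ∀ i, Sum.elim k b i ∈ Submodule.span ℂ (Set.range (Sum.elim k b)) :=
        fun i => Submodule.subset_span ⟨i, rfl⟩
      rintro (i | i)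
      · exact hmem (Sum.inl i)
      · simp only [w, P, Sum.elim_inr, sub_self, zero_smul, Matrix.zero_apply, zero_add]
        exact Submodule.sum_mem _ fun j _ => Submodule.smul_mem _ _ (hmem (Sum.inr j))
    · change finrank ℂ (Submodule.span ℂ (Set.range (w 1))) = _
      rw [finrank_span_eq_card (hli 1),
        finrank_span_eq_card ((h.symm hsymm).linearIndependent_left hsymm)]
  rw [← hγ0, ← hγ1]
  exact connectedComponent_eq
    ((isPreconnected_range hγ).subset_connectedComponent ⟨0, rfl⟩ ⟨1, rfl⟩)

theorem subspacePhase_sq {m : ℕ} {e : Y ≃ₗ[ℂ] (Fin m ⊕ Fin m → ℂ)}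
    (hB : ∀ x y, B x y = e x ⬝ᵥ e y) {W : Submodule ℂ Y} (hW : IsIsotropic B W)
    (hd : finrank ℂ W = m) : subspacePhase e W ^ 2 = (-1) ^ m := by
  let c := Module.finBasisOfFinrankEq ℂ W hd
  let v : Fin m → Y := fun i => (c i : Y)
  have hv : LinearIndependent ℂ v := c.linearIndependent.map' W.subtype W.ker_subtype
  have hs : Submodule.span ℂ (Set.range v) = W := by
    apply Submodule.eq_of_le_of_finrank_eq
    · rw [Submodule.span_le, Set.range_subset_iff]
      exact fun i => (c i).2
    · rw [finrank_span_eq_card hv, hd, Fintype.card_fin]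
  rw [← hs, subspacePhase_span e hv, phase_sq (transpose_mul_frameCoords hB fun i j =>
    hW _ (c i).2 _ (c j).2) (gram_det_ne_zero e hv), Fintype.card_fin]

/-- On isotropic subspaces the continuous function `subspacePhase` takes at most two values, so it
is constant on connected components. -/
theorem subspacePhase_eq_of_connectedComponent_eq [TopologicalSpace Y] [IsTopologicalAddGroup Y]
    [ContinuousSMul ℂ Y] [T2Space Y] {m : ℕ} {e : Y ≃ₗ[ℂ] (Fin m ⊕ Fin m → ℂ)}
    (hB : ∀ x y, B x y = e x ⬝ᵥ e y)
    (hm : ∀ H : IsotropicGrassmannian B, finrank ℂ H.1 = m) {H₁ H₂ : IsotropicGrassmannian B}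
    (h : connectedComponent H₁ = connectedComponent H₂) :
    subspacePhase e H₁.1 = subspacePhase e H₂.1 := by
  let f : IsotropicGrassmannian B → ℂ := fun H => subspacePhase e H.1
  have hf : Continuous f := by
    let : TopologicalSpace (Submodule ℂ Y) := grassmannianTopology Y
    exact (continuous_subspacePhase e).comp continuous_induced_dom
  have hsq : ∀ H, f H ^ 2 = (-1) ^ m := fun H => subspacePhase_sq hB H.2.prop (hm H)
  have hsub : f '' connectedComponent H₁ ⊆ {f H₁, -f H₁} := by
    rintro _ ⟨H, -, rfl⟩
    exact sq_eq_sq_iff_eq_or_eq_neg.mp ((hsq H).trans (hsq H₁).symm)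
  have htd : IsTotallyDisconnected ({f H₁, -f H₁} : Set ℂ) :=
    (Set.toFinite _).countable.isTotallyDisconnected
  exact htd _ hsub (isPreconnected_connectedComponent.image f hf.continuousOn)
    ⟨H₁, mem_connectedComponent, rfl⟩ ⟨H₂, h ▸ mem_connectedComponent, rfl⟩

theorem connectedComponent_eq_of_even_codimInter [TopologicalSpace Y] [IsTopologicalAddGroup Y]
    [ContinuousSMul ℂ Y] (hsymm : B.IsSymm) (hnd : B.Nondegenerate)
    (hdim : Even (finrank ℂ Y)) {H₁ H₂ : IsotropicGrassmannian B}
    (h : Even (codimInter H₁.1 H₂.1)) : connectedComponent H₁ = connectedComponent H₂ := by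
  have hd₁ := two_mul_finrank_of_maximal hsymm hnd hdim H₁.2
  have hd₂ := two_mul_finrank_of_maximal hsymm hnd hdim H₂.2
  obtain ⟨k, a, b, hF, hs₁, hs₂⟩ :=
    exists_isHyperbolicFrame hsymm hnd H₁.2.prop H₂.2.prop hd₁ hd₂
  obtain ⟨s, hs⟩ := h
  have hK := codimInter_add_finrank_inf H₁.1 H₂.1
  let σ : Fin s ⊕ Fin s ≃ Fin (codimInter H₁.1 H₂.1) := Fintype.equivOfCardEq (by simp [hs])
  have hr : ∀ c : Fin (codimInter H₁.1 H₂.1) → Y,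
      Set.range (Sum.elim k (c ∘ σ)) = Set.range (Sum.elim k c) := by
    intro c
    rw [Set.Sum.elim_range, Set.Sum.elim_range, EquivLike.range_comp]
  refine connectedComponent_eq_of_even hsymm hnd (hF.reindex σ) ?_ (by rw [hr, hs₁])
    (by rw [hr, hs₂])
  simp
  omega

/-- If `H₁ ≠ H₂`, one vector of a frame of `H₁` can be exchanged for one of `H₂`. The resulting
`H₃` has phase opposite to that of `H₁`, and its relative position to `H₂` is described by one
vector less. -/
theorem exists_subspacePhase_eq_neg_of_codimInter (hsymm : B.IsSymm) (hnd : B.Nondegenerate)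
    {m : ℕ} {e : Y ≃ₗ[ℂ] (Fin m ⊕ Fin m → ℂ)} (hB : ∀ x y, B x y = e x ⬝ᵥ e y)
    (hm : ∀ H : IsotropicGrassmannian B, finrank ℂ H.1 = m) {H₁ H₂ : IsotropicGrassmannian B}
    {ι : Type*} [Fintype ι] [DecidableEq ι] (h : codimInter H₁.1 H₂.1 = Fintype.card ι + 1) :
    ∃ (H₃ : IsotropicGrassmannian B)
      (k : Fin (finrank ℂ (H₁.1 ⊓ H₂.1 : Submodule ℂ Y)) ⊕ Unit → Y) (a b : ι → Y),
      IsHyperbolicFrame B k a b ∧ Submodule.span ℂ (Set.range (Sum.elim k a)) = H₃.1 ∧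
      Submodule.span ℂ (Set.range (Sum.elim k b)) = H₂.1 ∧
      subspacePhase e H₃.1 = -subspacePhase e H₁.1 := by
  have hY : finrank ℂ Y = 2 * m := by rw [e.finrank_eq]; simp; ring
  obtain ⟨k, a, b, hF, hs₁, hs₂⟩ := exists_isHyperbolicFrame hsymm hnd H₁.2.prop H₂.2.prop
    (by rw [hm, hY]) (by rw [hm, hY])
  have hK := codimInter_add_finrank_inf H₁.1 H₂.1
  rw [hm] at hK
  let σ : Unit ⊕ ι ≃ Fin (codimInter H₁.1 H₂.1) :=
    Fintype.equivOfCardEq (by simp [h, add_comm])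
  have hr : ∀ c : Fin (codimInter H₁.1 H₂.1) → Y,
      Set.range (Sum.elim k (c ∘ σ)) = Set.range (Sum.elim k c) := by
    intro c
    rw [Set.Sum.elim_range, Set.Sum.elim_range, EquivLike.range_comp]
  have hF' := hF.reindex σ
  have hF'' := hF'.absorb_unit hsymm
  let H₃ : IsotropicGrassmannian B := isotropicSpan hnd _ (hF''.linearIndependent_left hsymm)
    (hF''.isotropic_left hsymm) (by simp; omega)
  refine ⟨H₃, _, _, _, hF'', rfl, ?_, ?_⟩
  · refine Eq.trans ?_ hs₂
    congr 1
    ext y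
    simp [or_assoc, σ.surjective.exists (p := fun z => b z = y)]
  · have := hF'.subspacePhase_absorb_unit hsymm hnd hB (by simp; omega)
    rwa [hr, hs₁] at this

theorem subspacePhase_eq_neg_of_odd_codimInter [TopologicalSpace Y] [IsTopologicalAddGroup Y]
    [ContinuousSMul ℂ Y] [T2Space Y] (hsymm : B.IsSymm) (hnd : B.Nondegenerate)
    {m : ℕ} {e : Y ≃ₗ[ℂ] (Fin m ⊕ Fin m → ℂ)} (hB : ∀ x y, B x y = e x ⬝ᵥ e y)
    (hm : ∀ H : IsotropicGrassmannian B, finrank ℂ H.1 = m) {H₁ H₂ : IsotropicGrassmannian B}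
    (h : Odd (codimInter H₁.1 H₂.1)) : subspacePhase e H₂.1 = -subspacePhase e H₁.1 := by
  have hY : finrank ℂ Y = 2 * m := by rw [e.finrank_eq]; simp; ring
  obtain ⟨s, hs⟩ := h
  have hK := codimInter_add_finrank_inf H₁.1 H₂.1
  rw [hm] at hK
  obtain ⟨H₃, k, a, b, hF, hs₃, hs₂, hphase⟩ := exists_subspacePhase_eq_neg_of_codimInter hsymm
    hnd hB hm (ι := Fin s ⊕ Fin s) (H₁ := H₁) (H₂ := H₂) (by simp; omega)
  have h32 : connectedComponent H₃ = connectedComponent H₂ :=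
    connectedComponent_eq_of_even hsymm hnd hF (by simp; omega) hs₃ hs₂
  rw [← subspacePhase_eq_of_connectedComponent_eq hB hm h32, hphase]

theorem exists_subspacePhase_eq_neg (hsymm : B.IsSymm) (hnd : B.Nondegenerate)
    {m : ℕ} {e : Y ≃ₗ[ℂ] (Fin m ⊕ Fin m → ℂ)} (hB : ∀ x y, B x y = e x ⬝ᵥ e y) (hm0 : m ≠ 0)
    (hm : ∀ H : IsotropicGrassmannian B, finrank ℂ H.1 = m) (H₁ : IsotropicGrassmannian B) :
    ∃ H₂ : IsotropicGrassmannian B, subspacePhase e H₂.1 = -subspacePhase e H₁.1 := by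
  have hne : H₁.1 ≠ ⊥ := by
    intro h
    have := hm H₁
    rw [h, finrank_bot] at this
    exact hm0 this.symm
  obtain ⟨x, hx, hx0⟩ := Submodule.exists_mem_ne_zero_of_ne_bot hne
  -- A maximal isotropic subspace containing the conjugate of `x` is different from `H₁`.
  set y := e.symm (star (e x)) with hy
  have hey : e y = star (e x) := by simp [hy]
  have hyy : B y y = 0 := by
    have h1 : e x ⬝ᵥ e x = 0 := by rw [← hB]; exact H₁.2.prop x hx x hx
    rw [hB, hey]
    simpa [dotProduct] using congrArg star h1
  have hxy : B x y ≠ 0 := by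
    open scoped ComplexOrder in
    rw [hB, hey, Ne, dotProduct_self_star_eq_zero]
    simpa using hx0
  obtain ⟨W, hyW, hW⟩ := (isIsotropic_span (B := B) (v := fun _ : Unit => y)
    fun _ _ => hyy).exists_le_maximal
  let H : IsotropicGrassmannian B := ⟨W, hW⟩
  have hr : codimInter H₁.1 H.1 ≠ 0 := by
    intro h0
    have hK := codimInter_add_finrank_inf H₁.1 H.1
    have h1 : H₁.1 ⊓ H.1 = H₁.1 := Submodule.eq_of_le_of_finrank_eq inf_le_left (by omega)
    have h2 : x ∈ H.1 := by
      rw [← h1] at hx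
      exact hx.2
    exact hxy (hW.prop x h2 y (hyW (Submodule.subset_span ⟨(), rfl⟩)))
  obtain ⟨s, hs⟩ := Nat.exists_eq_succ_of_ne_zero hr
  obtain ⟨H₃, -, -, -, -, -, -, h⟩ := exists_subspacePhase_eq_neg_of_codimInter hsymm hnd hB hm
    (ι := Fin s) (H₁ := H₁) (H₂ := H) (by simpa using hs)
  exact ⟨H₃, h⟩

end Components

theorem mainTheorem5 {Y : Type*} [AddCommGroup Y] [Module ℂ Y] [FiniteDimensional ℂ Y]
    [TopologicalSpace Y] [IsTopologicalAddGroup Y] [ContinuousSMul ℂ Y] [T2Space Y]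
    (B : LinearMap.BilinForm ℂ Y) (hsymm : B.IsSymm) (hnd : B.Nondegenerate)
    (hdim : Even (Module.finrank ℂ Y)) :
    (Module.finrank ℂ Y ≠ 0 → Nat.card (ConnectedComponents (IsotropicGrassmannian B)) = 2) ∧
    ∀ H₁ H₂ : IsotropicGrassmannian B,
      connectedComponent H₁ = connectedComponent H₂ ↔
        Even (codimInter H₁.1 H₂.1) ∧ Even (codimInter H₂.1 H₁.1) := by
  obtain ⟨m, hm2⟩ := id hdim
  obtain ⟨e, hB⟩ := exists_equiv_dotProduct (n := Fin m ⊕ Fin m) hsymm hnd (by simp [hm2])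
  have hm : ∀ H : IsotropicGrassmannian B, Module.finrank ℂ H.1 = m := fun H => by
    have := two_mul_finrank_of_maximal hsymm hnd hdim H.2
    omega
  have hne : ∀ H : IsotropicGrassmannian B, subspacePhase e H.1 ≠ -subspacePhase e H.1 := by
    intro H h
    have h0 : subspacePhase e H.1 = 0 := by simpa [self_eq_neg] using h
    have := subspacePhase_sq hB H.2.prop (hm H)
    rw [h0] at this
    exact pow_ne_zero m (by norm_num : (-1 : ℂ) ≠ 0) (by rw [← this]; simp)
  have hiff : ∀ H₁ H₂ : IsotropicGrassmannian B,
      connectedComponent H₁ = connectedComponent H₂ ↔ Even (codimInter H₁.1 H₂.1) := by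
    refine fun H₁ H₂ => ⟨fun h => ?_, connectedComponent_eq_of_even_codimInter hsymm hnd hdim⟩
    by_contra hodd
    have h1 := subspacePhase_eq_neg_of_odd_codimInter hsymm hnd hB hm
      (Nat.not_even_iff_odd.mp hodd)
    exact hne H₁ ((subspacePhase_eq_of_connectedComponent_eq hB hm h).trans h1)
  refine ⟨fun h0 => ?_, fun H₁ H₂ => ⟨fun h => ⟨(hiff _ _).mp h, (hiff _ _).mp h.symm⟩,
    fun h => (hiff _ _).mpr h.1⟩⟩
  obtain ⟨W, -, hW⟩ := IsIsotropic.exists_le_maximal (B := B) (W := ⊥) (by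
    intro x hx y _
    simp [(Submodule.mem_bot ℂ).mp hx])
  let H₁ : IsotropicGrassmannian B := ⟨W, hW⟩
  obtain ⟨H₂, h12⟩ := exists_subspacePhase_eq_neg hsymm hnd hB (by omega) hm H₁
  rw [Nat.card_eq_two_iff]
  refine ⟨(H₁ : ConnectedComponents _), (H₂ : ConnectedComponents _), fun h => ?_, ?_⟩
  · have := subspacePhase_eq_of_connectedComponent_eq hB hm (ConnectedComponents.coe_eq_coe.mp h)
    exact hne H₁ (this.trans h12)
  · refine Set.eq_univ_of_forall fun x => ?_
    obtain ⟨H, rfl⟩ := ConnectedComponents.surjective_coe x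
    rcases Nat.even_or_odd (codimInter H₁.1 H.1) with h | h
    · left
      exact (ConnectedComponents.coe_eq_coe.mpr ((hiff _ _).mpr h)).symm
    · right
      have h1 := subspacePhase_eq_neg_of_odd_codimInter hsymm hnd hB hm h
      refine (ConnectedComponents.coe_eq_coe.mpr ((hiff _ _).mpr ?_)).symm
      by_contra h2
      have h3 := subspacePhase_eq_neg_of_odd_codimInter hsymm hnd hB hm
        (Nat.not_even_iff_odd.mp h2)
      exact hne H₂ ((h12.trans h1.symm).trans h3)
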